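/- Let $k$ be an algebraically closed field (of any characteristic), let $G$ be a finite group, and let $k[G]$ be the group algebra with its standard Hopf algebra structure: the comultiplication $\Delta$ and the counit $\varepsilon$ are the $k$-algebra maps with $\Delta(g)=g\otimes g$ and $\varepsilon(g)=1$ for $g\in G$. Let $I$ be the identity map of $k[G]$. A twist for $k[G]$ is an invertible element $J\in k[G]\otimes k[G]$ such that $$(\Delta\otimes I)(J)\,J_{12}=(I\otimes\Delta)(J)\,J_{23}\quad\text{and}\quad(\varepsilon\otimes I)(J)=(I\otimes\varepsilon)(J)=1,$$ where $J_{12}=J\otimes 1$ and $J_{23}=1\otimes J$ in $k[G]^{\otimes 3}$. Twists $J$ and $J'$ are gauge equivalent if $J'=\Delta(x)J(x^{-1}\otimes x^{-1})$ for some invertible $x\in k[G]$. Every symmetric twist $J$ for $k[G]$ (that is, every twist with $J_{21}=J$, where $J_{21}$ is the image of $J$ under the flip $a\otimes b\mapsto b\otimes a$) is gauge equivalent to $1\otimes 1$. -/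

import Mathlib

open scoped TensorProduct

namespace HopfTwist

variable {k A : Type*} [Field k] [Ring A] [HopfAlgebra k A]

/-- A twist for the Hopf algebra `A` over `k`: an invertible element `J` of `A ⊗ A` with
`(Δ ⊗ I)(J) J₁₂ = (I ⊗ Δ)(J) J₂₃` in `A ⊗ A ⊗ A` and `(ε ⊗ I)(J) = (I ⊗ ε)(J) = 1`. -/
structure IsTwist (J : A ⊗[k] A) : Prop where
  isUnit : IsUnit J
  cocycle :
    Algebra.TensorProduct.assoc k k k A A A
        (Algebra.TensorProduct.map (Bialgebra.comulAlgHom k A) (AlgHom.id k A) J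
          * (J ⊗ₜ[k] (1 : A))) =
      Algebra.TensorProduct.map (AlgHom.id k A) (Bialgebra.comulAlgHom k A) J
        * ((1 : A) ⊗ₜ[k] J)
  counit_left :
    Algebra.TensorProduct.lid k A
      (Algebra.TensorProduct.map (Bialgebra.counitAlgHom k A) (AlgHom.id k A) J) = 1
  counit_right :
    Algebra.TensorProduct.rid k k A
      (Algebra.TensorProduct.map (AlgHom.id k A) (Bialgebra.counitAlgHom k A) J) = 1

/-- `J` is symmetric: `J₂₁ = J`, where `J₂₁` is the image of `J` under the flip of `A ⊗ A`. -/
def IsSymmetric (J : A ⊗[k] A) : Prop :=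
  Algebra.TensorProduct.comm k A A J = J

/-- `J^x = Δ(x) J (x⁻¹ ⊗ x⁻¹)`, for an invertible element `x` of `A`. -/
noncomputable def gaugeTransform (x : Aˣ) (J : A ⊗[k] A) : A ⊗[k] A :=
  Bialgebra.comulAlgHom k A (x : A) * J * (((x⁻¹ : Aˣ) : A) ⊗ₜ[k] ((x⁻¹ : Aˣ) : A))

/-- `J` and `J'` are gauge equivalent: `J' = J^x` for some invertible `x` in `A`. -/
def GaugeEquivalent (J J' : A ⊗[k] A) : Prop :=
  ∃ x : Aˣ, J' = gaugeTransform x J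

end HopfTwist

/-! The twist equations say exactly that `a ↦ Δ(a) J` is a coassociative comultiplication on `A`
with the old counit. If `J` is symmetric and `Δ` cocommutative, this new coalgebra is cocommutative,
so its dual is a commutative algebra and has a character over `k`. By finite dimension the character
is evaluation at some `x`, so `Δ(x) J = x ⊗ x` and `ε(x) = 1`. The antipode shows that `x` is
invertible, and `x` gauges `J` to `1 ⊗ 1`. -/

/-- A nonzero finite-dimensional commutative algebra over an algebraically closed field has a
character. -/
theorem nonempty_algHom_of_isAlgClosed (k D : Type*) [Field k] [IsAlgClosed k] [CommRing D]
    [Algebra k D] [Module.Finite k D] [Nontrivial D] : Nonempty (D →ₐ[k] k) := by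
  obtain ⟨I, hI⟩ := Ideal.exists_maximal D
  let : Field (D ⧸ I) := Ideal.Quotient.field I
  exact ⟨(IsAlgClosed.lift : (D ⧸ I) →ₐ[k] k).comp (Ideal.Quotient.mkₐ k I)⟩

open Coalgebra WithConv in
/-- A nonzero finite-dimensional cocommutative coalgebra over an algebraically closed field has a
group-like element: it is a character of the (commutative) convolution algebra on the dual. -/
theorem exists_isGroupLikeElem_of_isCocomm {k C : Type*} [Field k] [IsAlgClosed k]
    [AddCommGroup C] [Module k C] [Coalgebra k C] [IsCocomm k C] [FiniteDimensional k C]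
    [Nontrivial C] : ∃ x : C, IsGroupLikeElem k x := by
  let D := WithConv (C →ₗ[k] k)
  have hfin : Module.Finite k D :=
    Module.Finite.equiv (WithConv.linearEquiv k (C →ₗ[k] k)).symm
  have hnt : Nontrivial D := WithConv.instNontrivial
  obtain ⟨χ⟩ := nonempty_algHom_of_isAlgClosed k D
  let φ : Module.Dual k (Module.Dual k C) :=
    χ.toLinearMap ∘ₗ (WithConv.linearEquiv k (C →ₗ[k] k)).symm.toLinearMap
  -- Reflexivity of `C`: the character is evaluation at a vector `x`.
  obtain ⟨x, hx⟩ := (Module.evalEquiv k C).surjective φ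
  have hχ (f : C →ₗ[k] k) : f x = χ (toConv f) := LinearMap.congr_fun hx f
  refine ⟨x, ⟨?_, ?_⟩⟩
  · rw [hχ]
    exact map_one χ
  · let b := Module.finBasis k C
    refine (b.tensorProduct b).ext_elem fun ⟨i, j⟩ ↦ ?_
    have hrepr (z : C ⊗[k] C) : (b.tensorProduct b).repr z (i, j) =
        LinearMap.mul' k k (TensorProduct.map (b.coord i) (b.coord j) z) := by
      induction z with
      | zero => simp
      | tmul c d => simp [mul_comm]
      | add z w hz hw => simp only [map_add, Finsupp.add_apply, hz, hw]
    -- Multiplicativity of `χ` on two coordinate functionals is the `(i, j)` coordinate of `Δ(x) = x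
    -- ⊗ x`.
    have hmul := hχ (toConv (b.coord i) * toConv (b.coord j)).ofConv
    rw [toConv_ofConv, map_mul, ← hχ, ← hχ] at hmul
    rw [hrepr, hrepr, TensorProduct.map_tmul, LinearMap.mul'_apply, ← hmul]
    rfl

namespace HopfTwist

variable {k A : Type*} [Field k] [Ring A] [HopfAlgebra k A] {J : A ⊗[k] A}

/-- The comultiplication `a ↦ Δ(a) J`. -/
noncomputable def twistedComul (J : A ⊗[k] A) : A →ₗ[k] A ⊗[k] A :=
  LinearMap.mulRight k J ∘ₗ Coalgebra.comul

@[simp]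
theorem twistedComul_apply (J : A ⊗[k] A) (a : A) :
    twistedComul J a = Bialgebra.comulAlgHom k A a * J := rfl

theorem rTensor_twistedComul (J z : A ⊗[k] A) :
    (twistedComul J).rTensor A z =
      Algebra.TensorProduct.map (Bialgebra.comulAlgHom k A) (AlgHom.id k A) z
        * (J ⊗ₜ[k] (1 : A)) := by
  induction z with
  | zero => simp
  | tmul c d => simp
  | add z w hz hw => simp only [map_add, add_mul, hz, hw]

theorem lTensor_twistedComul (J z : A ⊗[k] A) :
    (twistedComul J).lTensor A z =
      Algebra.TensorProduct.map (AlgHom.id k A) (Bialgebra.comulAlgHom k A) z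
        * ((1 : A) ⊗ₜ[k] J) := by
  induction z with
  | zero => simp
  | tmul c d => simp
  | add z w hz hw => simp only [map_add, add_mul, hz, hw]

/-- A twist `J` makes `A` a coalgebra with comultiplication `a ↦ Δ(a) J` and the counit of `A`. -/
noncomputable abbrev IsTwist.coalgebra (hJ : IsTwist J) : Coalgebra k A where
  comul := twistedComul J
  counit := Coalgebra.counit
  coassoc := by
    ext a
    have hΔ : Algebra.TensorProduct.assoc k k k A A A (Algebra.TensorProduct.map
        (Bialgebra.comulAlgHom k A) (AlgHom.id k A) (Bialgebra.comulAlgHom k A a)) =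
        Algebra.TensorProduct.map (AlgHom.id k A) (Bialgebra.comulAlgHom k A)
          (Bialgebra.comulAlgHom k A a) := Coalgebra.coassoc_apply a
    change Algebra.TensorProduct.assoc k k k A A A
      ((twistedComul J).rTensor A (twistedComul J a)) =
        (twistedComul J).lTensor A (twistedComul J a)
    -- Each side is an iterated coproduct of `a` times one side of the cocycle equation.
    rw [rTensor_twistedComul, lTensor_twistedComul, twistedComul_apply,
      map_mul (Algebra.TensorProduct.map _ _), mul_assoc, map_mul, hΔ, hJ.cocycle,
      map_mul, mul_assoc]
  rTensor_counit_comp_comul := by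
    ext a
    have hε : Algebra.TensorProduct.map (Bialgebra.counitAlgHom k A) (AlgHom.id k A)
        (Bialgebra.comulAlgHom k A a) = 1 ⊗ₜ a := Coalgebra.rTensor_counit_comul a
    change Algebra.TensorProduct.map (Bialgebra.counitAlgHom k A) (AlgHom.id k A)
      (Bialgebra.comulAlgHom k A a * J) = 1 ⊗ₜ a
    apply (Algebra.TensorProduct.lid k A).injective
    rw [map_mul, map_mul, hJ.counit_left, mul_one, hε]
  lTensor_counit_comp_comul := by
    ext a
    have hε : Algebra.TensorProduct.map (AlgHom.id k A) (Bialgebra.counitAlgHom k A)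
        (Bialgebra.comulAlgHom k A a) = a ⊗ₜ 1 := Coalgebra.lTensor_counit_comul a
    change Algebra.TensorProduct.map (AlgHom.id k A) (Bialgebra.counitAlgHom k A)
      (Bialgebra.comulAlgHom k A a * J) = a ⊗ₜ 1
    apply (Algebra.TensorProduct.rid k k A).injective
    rw [map_mul, map_mul, hJ.counit_right, mul_one, hε]

theorem IsTwist.isCocomm_coalgebra [Coalgebra.IsCocomm k A] (hJ : IsTwist J)
    (hsymm : IsSymmetric J) :
    letI := hJ.coalgebra
    Coalgebra.IsCocomm k A := by
  refine @Coalgebra.IsCocomm.mk k A _ _ _ hJ.coalgebra ?_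
  ext a
  have hΔ : Algebra.TensorProduct.comm k A A (Bialgebra.comulAlgHom k A a) =
      Bialgebra.comulAlgHom k A a := Coalgebra.comm_comul k a
  change Algebra.TensorProduct.comm k A A (Bialgebra.comulAlgHom k A a * J) =
    Bialgebra.comulAlgHom k A a * J
  rw [map_mul, hΔ, hsymm]

/-- `m (I ⊗ S)` applied to `(x ⊗ x) z` is `x` times something. -/
theorem exists_mul_antipode_lTensor_eq (x : A) (z : A ⊗[k] A) :
    ∃ y, LinearMap.mul' k A ((HopfAlgebra.antipode k).lTensor A ((x ⊗ₜ[k] x) * z)) = x * y := by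
  induction z with
  | zero => exact ⟨0, by simp⟩
  | tmul c d => exact ⟨c * HopfAlgebra.antipode k (x * d), by simp [mul_assoc]⟩
  | add z w hz hw =>
    obtain ⟨y, hy⟩ := hz
    obtain ⟨y', hy'⟩ := hw
    exact ⟨y + y', by rw [mul_add, map_add, map_add, hy, hy', mul_add]⟩

/-- An element `x` with `ε(x) = 1` and `Δ(x) J = x ⊗ x`, for an invertible `J`, is invertible. -/
theorem isUnit_of_comul_mul_eq [FiniteDimensional k A] (hJ : IsUnit J) {x : A}
    (hε : Coalgebra.counit (R := k) x = 1)
    (hx : Bialgebra.comulAlgHom k A x * J = x ⊗ₜ[k] x) : IsUnit x := by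
  obtain ⟨u, rfl⟩ := hJ
  -- Apply `m (I ⊗ S)` to `Δ(x) = (x ⊗ x) J⁻¹`: the left side gives `ε(x) 1 = 1`, the right side `x
  -- y`.
  obtain ⟨y, hy⟩ := exists_mul_antipode_lTensor_eq x (↑u⁻¹ : A ⊗[k] A)
  -- In an Artinian ring a right inverse is two-sided.
  have : IsArtinianRing A := IsArtinianRing.of_finite k A
  rw [← hx, Units.mul_inv_cancel_right, Bialgebra.comulAlgHom_apply,
    HopfAlgebra.mul_antipode_lTensor_comul_apply, hε, map_one] at hy
  exact .of_mul_eq_one y hy.symm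

/-- Over an algebraically closed field, every symmetric twist for a finite-dimensional
cocommutative Hopf algebra is gauge equivalent to `1 ⊗ 1`. -/
theorem IsTwist.gaugeEquivalent_one [IsAlgClosed k] [FiniteDimensional k A] [Nontrivial A]
    [Coalgebra.IsCocomm k A] (hJ : IsTwist J) (hsymm : IsSymmetric J) :
    GaugeEquivalent J ((1 : A) ⊗ₜ[k] (1 : A)) := by
  obtain ⟨x, hx⟩ := @exists_isGroupLikeElem_of_isCocomm k A _ _ _ _ hJ.coalgebra
    (hJ.isCocomm_coalgebra hsymm) _ _
  have hΔ : Bialgebra.comulAlgHom k A x * J = x ⊗ₜ[k] x :=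
    @IsGroupLikeElem.comul_eq_tmul_self k A _ _ _ hJ.coalgebra x hx
  have hε : Coalgebra.counit (R := k) x = 1 :=
    @IsGroupLikeElem.counit_eq_one k A _ _ _ hJ.coalgebra x hx
  obtain ⟨u, rfl⟩ := isUnit_of_comul_mul_eq hJ.isUnit hε hΔ
  refine ⟨u, ?_⟩
  rw [gaugeTransform, hΔ, Algebra.TensorProduct.tmul_mul_tmul, Units.mul_inv]

end HopfTwist

theorem corollary3p3 {k : Type*} [Field k] [IsAlgClosed k] {G : Type*} [Group G] [Finite G]
    (J : MonoidAlgebra k G ⊗[k] MonoidAlgebra k G)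
    (hJ : HopfTwist.IsTwist J) (hsymm : HopfTwist.IsSymmetric J) :
    HopfTwist.GaugeEquivalent J
      ((1 : MonoidAlgebra k G) ⊗ₜ[k] (1 : MonoidAlgebra k G)) := by
  exact hJ.gaugeEquivalent_one hsymm
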